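/- Let $R$ be a Krull domain, that is, an integral domain with field of fractions $K$ for which there is a set $\mathcal V$ of discrete valuation rings of $K$ such that $R=\bigcap_{V\in\mathcal V}V$ (the empty intersection being $K$, so that fields are Krull domains) and every nonzero element of $K$ is a unit in all but finitely many $V\in\mathcal V$. For a nonzero fractional ideal $I$ of $R$ put $I^{-1}=\{x\in K : xI\subseteq R\}$ and call $I$ divisorial if $(I^{-1})^{-1}=I$. The divisorial fractional ideals of $R$ form an abelian group $\mathrm{Div}(R)$ under $I\circ J=((IJ)^{-1})^{-1}$, and the divisor class group is $\mathsf{Cl}(R)=\mathrm{Div}(R)/\mathrm{Prin}(R)$, where $\mathrm{Prin}(R)$ is the subgroup of nonzero principal fractional ideals; $[I]$ denotes the class of $I$. Let $E$ be a finitely generated projective $R$-module. Then the symmetric algebra $S=S_R(E)$ is a Krull domain; for every divisorial fractional ideal $L$ of $R$, the fractional ideal $LS$ of $S$ generated by $L$ is divisorial; and the mapping $$\mathsf{Cl}(R)\longrightarrow\mathsf{Cl}(S),\qquad [L]\mapsto[LS],$$ is a well-defined isomorphism of groups. -/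

import Mathlib

open scoped nonZeroDivisors

/-- `R` is a *Krull domain*: it is an integral domain, and there is a set `𝒱` of discrete valuation
rings of its field of fractions `K` such that `R = ⋂ V ∈ 𝒱, V` (the empty intersection being `K`),
and every nonzero element of `K` is a unit in all but finitely many `V ∈ 𝒱`.
In particular every field is a Krull domain. -/
class IsKrullDomain (R : Type*) [CommRing R] : Prop extends IsDomain R where
  exists_valuationSubrings : ∃ 𝒱 : Set (ValuationSubring (FractionRing R)),
    (∀ V ∈ 𝒱, IsDiscreteValuationRing V) ∧
    (∀ x : FractionRing R, x ∈ (algebraMap R (FractionRing R)).range ↔ ∀ V ∈ 𝒱, x ∈ V) ∧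
    (∀ x : FractionRing R, x ≠ 0 → {V ∈ 𝒱 | V.valuation x ≠ 1}.Finite)

namespace KrullDomain

noncomputable section

section Divisorial

variable {R : Type*} [CommRing R] [IsDomain R]

/-- A fractional ideal `I` of a domain `R` is *divisorial* if it is nonzero and `(I⁻¹)⁻¹ = I`,
where `I⁻¹ = (R : I) = {x ∈ K | x I ⊆ R}`. -/
def IsDivisorial (I : FractionalIdeal R⁰ (FractionRing R)) : Prop :=
  I ≠ 0 ∧ I⁻¹⁻¹ = I

lemma inv_ne_zero_of_ne_zero {I : FractionalIdeal R⁰ (FractionRing R)} (hI : I ≠ 0) :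
    I⁻¹ ≠ 0 := by
  obtain ⟨a, ha, h⟩ := I.isFractional
  intro h0
  have hmem : algebraMap R (FractionRing R) a ∈ I⁻¹ := by
    rw [FractionalIdeal.mem_inv_iff hI]
    intro y hy
    obtain ⟨r, hr⟩ := h y hy
    rw [FractionalIdeal.mem_one_iff]
    exact ⟨r, by rw [hr, Algebra.smul_def]⟩
  rw [h0, FractionalIdeal.mem_zero_iff] at hmem
  exact nonZeroDivisors.ne_zero ha ((IsFractionRing.injective R (FractionRing R)) (by simpa using hmem))

lemma frac_mul_ne_zero {I J : FractionalIdeal R⁰ (FractionRing R)} (hI : I ≠ 0) (hJ : J ≠ 0) :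
    I * J ≠ 0 := by
  obtain ⟨x, hx, hx0⟩ : ∃ x ∈ I, x ≠ 0 := by
    by_contra! h
    exact hI (FractionalIdeal.eq_zero_iff.2 h)
  obtain ⟨y, hy, hy0⟩ : ∃ y ∈ J, y ≠ 0 := by
    by_contra! h
    exact hJ (FractionalIdeal.eq_zero_iff.2 h)
  intro h
  exact mul_ne_zero hx0 hy0
    (FractionalIdeal.eq_zero_iff.1 h _ (FractionalIdeal.mul_mem_mul hx hy))

lemma le_inv_iff_mul_le_one {I J : FractionalIdeal R⁰ (FractionRing R)} (hJ : J ≠ 0) :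
    I ≤ J⁻¹ ↔ I * J ≤ 1 :=
  FractionalIdeal.le_div_iff_mul_le hJ

lemma le_inv_inv {I : FractionalIdeal R⁰ (FractionRing R)} (hI : I ≠ 0) : I ≤ I⁻¹⁻¹ := by
  rw [le_inv_iff_mul_le_one (inv_ne_zero_of_ne_zero hI), mul_comm,
    ← le_inv_iff_mul_le_one hI]

lemma inv_inv_inv {I : FractionalIdeal R⁰ (FractionRing R)} (hI : I ≠ 0) : I⁻¹⁻¹⁻¹ = I⁻¹ := by
  have h1 := inv_ne_zero_of_ne_zero hI
  refine le_antisymm ?_ (le_inv_inv h1)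
  exact FractionalIdeal.inv_anti_mono hI (inv_ne_zero_of_ne_zero h1) (le_inv_inv hI)

lemma inv_inv_mul_inv {I J : FractionalIdeal R⁰ (FractionRing R)} (hI : I ≠ 0) (hJ : J ≠ 0) :
    (I⁻¹⁻¹ * J)⁻¹ = (I * J)⁻¹ := by
  have h1 := inv_ne_zero_of_ne_zero hI
  have h2 := inv_ne_zero_of_ne_zero h1
  refine eq_of_forall_le_iff fun X ↦ ?_
  rw [le_inv_iff_mul_le_one (frac_mul_ne_zero h2 hJ), le_inv_iff_mul_le_one (frac_mul_ne_zero hI hJ),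
    mul_comm I⁻¹⁻¹ J, mul_comm I J, ← mul_assoc, ← mul_assoc, ← le_inv_iff_mul_le_one h2,
    ← le_inv_iff_mul_le_one hI, inv_inv_inv hI]

lemma isDivisorial_inv_inv {I : FractionalIdeal R⁰ (FractionRing R)} (hI : I ≠ 0) :
    IsDivisorial I⁻¹⁻¹ :=
  ⟨inv_ne_zero_of_ne_zero (inv_ne_zero_of_ne_zero hI), by
    rw [inv_inv_inv (inv_ne_zero_of_ne_zero hI)]⟩

lemma isDivisorial_inv {I : FractionalIdeal R⁰ (FractionRing R)} (hI : I ≠ 0) :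
    IsDivisorial I⁻¹ :=
  ⟨inv_ne_zero_of_ne_zero hI, inv_inv_inv hI⟩

lemma isDivisorial_spanSingleton (x : (FractionRing R)ˣ) :
    IsDivisorial (FractionalIdeal.spanSingleton R⁰ (x : FractionRing R)) :=
  ⟨FractionalIdeal.spanSingleton_ne_zero_iff.2 x.ne_zero, by
    rw [FractionalIdeal.spanSingleton_inv, FractionalIdeal.spanSingleton_inv, inv_inv]⟩

lemma isDivisorial_one : IsDivisorial (1 : FractionalIdeal R⁰ (FractionRing R)) := by
  have h := isDivisorial_spanSingleton (R := R) 1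
  rwa [Units.val_one, FractionalIdeal.spanSingleton_one] at h

end Divisorial

/-- `Div(R)`: the divisorial fractional ideals of the domain `R`. -/
@[ext]
structure DivisorialIdeal (R : Type*) [CommRing R] [IsDomain R] where
  /-- The underlying fractional ideal. -/
  val : FractionalIdeal R⁰ (FractionRing R)
  isDivisorial : IsDivisorial val

namespace DivisorialIdeal

variable {R : Type*} [CommRing R]

section Domain

variable [IsDomain R]

/-- The operation `I ∘ J = ((I J)⁻¹)⁻¹` on divisorial ideals. -/
instance : Mul (DivisorialIdeal R) :=
  ⟨fun I J ↦ ⟨(I.val * J.val)⁻¹⁻¹, isDivisorial_inv_inv (frac_mul_ne_zero I.isDivisorial.1 J.isDivisorial.1)⟩⟩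

instance : One (DivisorialIdeal R) := ⟨⟨1, isDivisorial_one⟩⟩

instance : Inv (DivisorialIdeal R) := ⟨fun I ↦ ⟨I.val⁻¹, isDivisorial_inv I.isDivisorial.1⟩⟩

lemma val_mul (I J : DivisorialIdeal R) : (I * J).val = (I.val * J.val)⁻¹⁻¹ := rfl

lemma val_one : (1 : DivisorialIdeal R).val = 1 := rfl

lemma val_inv (I : DivisorialIdeal R) : (I⁻¹).val = I.val⁻¹ := rfl

protected lemma mul_comm' (I J : DivisorialIdeal R) : I * J = J * I :=
  DivisorialIdeal.ext (by rw [val_mul, val_mul, mul_comm])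

protected lemma mul_assoc' (I J L : DivisorialIdeal R) : I * J * L = I * (J * L) := by
  apply DivisorialIdeal.ext
  have hI := I.isDivisorial.1
  have hJ := J.isDivisorial.1
  have hL := L.isDivisorial.1
  rw [val_mul, val_mul, val_mul, val_mul, inv_inv_mul_inv (frac_mul_ne_zero hI hJ) hL,
    mul_comm I.val (_⁻¹⁻¹), inv_inv_mul_inv (frac_mul_ne_zero hJ hL) hI, mul_comm (J.val * L.val), mul_assoc]

protected lemma one_mul' (I : DivisorialIdeal R) : 1 * I = I :=
  DivisorialIdeal.ext (by rw [val_mul, val_one, one_mul, I.isDivisorial.2])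

end Domain

/-- A Krull domain is completely integrally closed. -/
lemma mem_range_of_pow_mul_mem [IsKrullDomain R] {d x : FractionRing R} (hd : d ≠ 0)
    (h : ∀ n : ℕ, d * x ^ n ∈ (algebraMap R (FractionRing R)).range) :
    x ∈ (algebraMap R (FractionRing R)).range := by
  obtain ⟨𝒱, hdvr, hmem, -⟩ := IsKrullDomain.exists_valuationSubrings (R := R)
  rw [hmem]
  intro V hV
  have := hdvr V hV
  by_contra hx
  have hx0 : x ≠ 0 := by rintro rfl; exact hx V.zero_mem
  have hxi : x⁻¹ ∈ V := (V.mem_or_inv_mem x).resolve_left hx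
  have hmax : (⟨x⁻¹, hxi⟩ : V) ∈ IsLocalRing.maximalIdeal V := by
    rw [IsLocalRing.mem_maximalIdeal, mem_nonunits_iff]
    intro hu
    obtain ⟨y, hy⟩ := hu.exists_right_inv
    have hy' : x⁻¹ * (y : FractionRing R) = 1 := congrArg Subtype.val hy
    have : x = y := by field_simp at hy'; exact hy'.symm
    exact hx (this ▸ y.2)
  have hdV : ∀ n : ℕ, d * x ^ n ∈ V := fun n ↦ (hmem _).1 (h n) V hV
  have hd0 : d ∈ V := by simpa using hdV 0
  have key : (⟨d, hd0⟩ : V) ∈ ⨅ n : ℕ, IsLocalRing.maximalIdeal V ^ n := by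
    rw [Ideal.mem_iInf]
    intro n
    have e : (⟨d, hd0⟩ : V) = ⟨d * x ^ n, hdV n⟩ * ⟨x⁻¹, hxi⟩ ^ n := by
      apply Subtype.ext
      change d = d * x ^ n * x⁻¹ ^ n
      rw [mul_assoc, ← mul_pow, mul_inv_cancel₀ hx0, one_pow, mul_one]
    rw [e]
    exact Ideal.mul_mem_left _ _ (Ideal.pow_mem_pow hmax n)
  rw [Ideal.iInf_pow_eq_bot_of_isLocalRing _ (IsLocalRing.maximalIdeal.isMaximal V).ne_top,
    Ideal.mem_bot] at key
  exact hd (congrArg Subtype.val key)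

protected lemma inv_mul_cancel' [IsKrullDomain R] (I : DivisorialIdeal R) : I⁻¹ * I = 1 := by
  apply DivisorialIdeal.ext
  rw [val_mul, val_inv, val_one]
  have hI := I.isDivisorial.1
  have hI' := inv_ne_zero_of_ne_zero hI
  have hle : I.val⁻¹ * I.val ≤ 1 := (le_inv_iff_mul_le_one hI).1 le_rfl
  have hinv : (I.val⁻¹ * I.val)⁻¹ = 1 := by
    apply le_antisymm
    · intro x hx
      have hx1 : FractionalIdeal.spanSingleton R⁰ x * I.val ≤ I.val := by
        conv_rhs => rw [← I.isDivisorial.2]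
        rw [le_inv_iff_mul_le_one hI', mul_assoc, mul_comm I.val,
          ← le_inv_iff_mul_le_one (frac_mul_ne_zero hI' hI), FractionalIdeal.spanSingleton_le_iff_mem]
        exact hx
      have hxI : ∀ y ∈ I.val, x * y ∈ I.val := fun y hy ↦
        hx1 (FractionalIdeal.mul_mem_mul (FractionalIdeal.mem_spanSingleton_self _ x) hy)
      obtain ⟨a, ha, hfrac⟩ := I.val.isFractional
      obtain ⟨y, hy, hy0⟩ : ∃ y ∈ I.val, y ≠ 0 := by
        by_contra! hcon
        exact hI (FractionalIdeal.eq_zero_iff.2 hcon)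
      have hpow : ∀ n : ℕ, y * x ^ n ∈ I.val := by
        intro n
        induction n with
        | zero => simpa using hy
        | succ n ih =>
          have e : y * x ^ (n + 1) = x * (y * x ^ n) := by ring
          rw [e]
          exact hxI _ ih
      have ha0 : algebraMap R (FractionRing R) a ≠ 0 := by
        rw [Ne, IsFractionRing.to_map_eq_zero_iff]
        exact nonZeroDivisors.ne_zero ha
      obtain ⟨r, hr⟩ := mem_range_of_pow_mul_mem (R := R) (x := x)
        (mul_ne_zero ha0 hy0) (fun n ↦ by
          obtain ⟨r, hr⟩ := hfrac _ (hpow n)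
          exact ⟨r, by rw [hr, Algebra.smul_def, mul_assoc]⟩)
      exact (FractionalIdeal.mem_one_iff _).2 ⟨r, hr⟩
    · rw [le_inv_iff_mul_le_one (frac_mul_ne_zero hI' hI), one_mul]
      exact hle
  rw [hinv, inv_one]

/-- Divisorial ideals of a Krull domain form a group under `I ∘ J = ((I J)⁻¹)⁻¹`. -/
instance [IsKrullDomain R] : CommGroup (DivisorialIdeal R) where
  mul_assoc := DivisorialIdeal.mul_assoc'
  one_mul := DivisorialIdeal.one_mul'
  mul_one I := by rw [DivisorialIdeal.mul_comm', DivisorialIdeal.one_mul']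
  inv_mul_cancel := DivisorialIdeal.inv_mul_cancel'
  mul_comm := DivisorialIdeal.mul_comm'

end DivisorialIdeal

/-- The homomorphism `Kˣ → Div(R)`, `x ↦ x R`. -/
def principalDivisor (R : Type*) [CommRing R] [IsKrullDomain R] :
    (FractionRing R)ˣ →* DivisorialIdeal R where
  toFun x := ⟨FractionalIdeal.spanSingleton R⁰ (x : FractionRing R), isDivisorial_spanSingleton x⟩
  map_one' := DivisorialIdeal.ext (by
    change FractionalIdeal.spanSingleton R⁰ (1 : FractionRing R) = 1
    rw [FractionalIdeal.spanSingleton_one])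
  map_mul' x y := DivisorialIdeal.ext (by
    rw [DivisorialIdeal.val_mul, FractionalIdeal.spanSingleton_mul_spanSingleton,
      ← Units.val_mul, (isDivisorial_spanSingleton (x * y)).2])

/-- The divisor class group `Cl(R) = Div(R) / Prin(R)` of a Krull domain. -/
abbrev DivisorClassGroup (R : Type*) [CommRing R] [IsKrullDomain R] : Type _ :=
  DivisorialIdeal R ⧸ (principalDivisor R).range

/-- The class `[I] ∈ Cl(R)` of a divisorial ideal `I`. -/
def divisorClass {R : Type*} [CommRing R] [IsKrullDomain R] (I : DivisorialIdeal R) :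
    DivisorClassGroup R :=
  QuotientGroup.mk I

end

end KrullDomain

/-- The structure map `R → S_R(E)` is injective. -/
instance SymmetricAlgebra.instFaithfulSMulBase (R E : Type*) [CommRing R] [AddCommGroup E]
    [Module R E] : FaithfulSMul R (SymmetricAlgebra R E) :=
  (faithfulSMul_iff_algebraMap_injective R (SymmetricAlgebra R E)).2
    (SymmetricAlgebra.algebraMap_leftInverse E).injective

-- The polynomial case carries the theorem. A finitely generated projective `E` has a projective
-- complement `F` with `E × F ≅ R^n`, so `T = S ⊗ Sym(F)` is isomorphic to `R[X_1, …, X_n]`, and `S`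
-- is a retract of `T`. Krull domains are stable under polynomial extension
-- (`isKrullDomain_polynomial`, through Gauss valuations) and under retracts
-- (`isKrullDomain_of_retract`), so `S` is Krull.
--
-- When `B` is projective over `A`, forming inverses of fractional ideals commutes with extension to
-- `B` (`extendedHom_inv`). Hence divisorial ideals extend to divisorial ideals and `Cl(A) → Cl(B)`
-- is a homomorphism, injective as soon as `A → B` has a retraction (`extendClass_injective`).
--
-- In `Cl(R) → Cl(S) → Cl(T)` the composite is surjective by Gauss's lemma
-- (`extendsAllClasses_polynomial`, iterated), and the second map is injective because `S` is a
-- retract of `T`. So the first map is surjective; it is injective by the augmentation `S → R`.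

universe u

namespace KrullDomain

open scoped WithZero Polynomial

/-! ### Gauss extension of a valuation to polynomials. -/

section Gauss

open Polynomial

variable {R Γ : Type*} [CommRing R] [LinearOrderedCommGroupWithZero Γ] (v : Valuation R Γ)

/-- The largest value of a coefficient of a polynomial. -/
noncomputable def coeffSup (p : R[X]) : Γ := p.support.sup fun i ↦ v (p.coeff i)

lemma le_coeffSup (p : R[X]) (i : ℕ) : v (p.coeff i) ≤ coeffSup v p := by
  by_cases h : p.coeff i = 0
  · simp [h]
  · exact Finset.le_sup (f := fun i ↦ v (p.coeff i)) (mem_support_iff.2 h)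

lemma coeffSup_le_iff {p : R[X]} {c : Γ} : coeffSup v p ≤ c ↔ ∀ i, v (p.coeff i) ≤ c :=
  ⟨fun h i ↦ (le_coeffSup v p i).trans h, fun h ↦ Finset.sup_le fun i _ ↦ h i⟩

lemma exists_coeffSup_eq (p : R[X]) :
    ∃ i, v (p.coeff i) = coeffSup v p ∧ ∀ j < i, v (p.coeff j) < coeffSup v p := by
  classical
  have h : ∃ i, v (p.coeff i) = coeffSup v p := by
    rcases p.support.eq_empty_or_nonempty with h | h
    · refine ⟨0, ?_⟩
      rw [support_eq_empty] at h
      simpa [h, coeffSup] using (bot_le.antisymm zero_le).symm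
    · obtain ⟨i, -, hi⟩ := Finset.exists_mem_eq_sup _ h fun i ↦ v (p.coeff i)
      exact ⟨i, hi.symm⟩
  exact ⟨Nat.find h, Nat.find_spec h, fun j hj ↦
    lt_of_le_of_ne (le_coeffSup v p j) (Nat.find_min h hj)⟩

/-- Gauss's lemma: if `i` and `j` are the least indices where the coefficients of `p` and `q` attain
their maximal values, then in the coefficient of degree `i + j` the term `(i, j)` strictly dominates
all others. -/
lemma coeffSup_mul (p q : R[X]) : coeffSup v (p * q) = coeffSup v p * coeffSup v q := by
  refine le_antisymm ((coeffSup_le_iff v).2 fun n ↦ ?_) ?_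
  · rw [coeff_mul]
    refine v.map_sum_le fun x _ ↦ ?_
    rw [map_mul]
    exact mul_le_mul' (le_coeffSup v p _) (le_coeffSup v q _)
  · obtain ⟨i, hi, hi'⟩ := exists_coeffSup_eq v p
    obtain ⟨j, hj, hj'⟩ := exists_coeffSup_eq v q
    by_cases hp : coeffSup v p = 0
    · simp [hp]
    by_cases hq : coeffSup v q = 0
    · simp [hq]
    refine le_of_eq_of_le ?_ (le_coeffSup v (p * q) (i + j))
    rw [coeff_mul, v.map_sum_eq_of_lt (j := (i, j)) (by simp), map_mul, hi, hj]
    rintro ⟨a, b⟩ hab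
    obtain ⟨hab, hne⟩ : a + b = i + j ∧ (a = i → b ≠ j) := by simpa using hab
    simp only [map_mul, hi, hj]
    have hp' := zero_lt_iff.2 hp
    have hq' := zero_lt_iff.2 hq
    rcases lt_or_ge a i with h | h
    · exact (mul_le_mul' le_rfl (le_coeffSup v q b)).trans_lt
        (mul_lt_mul_of_pos_right (hi' a h) hq')
    · exact (mul_le_mul' (le_coeffSup v p a) le_rfl).trans_lt
        (mul_lt_mul_of_pos_left (hj' b (by grind)) hp')

/-- The Gauss extension of a valuation to the polynomial ring. -/
noncomputable def gaussValuation : Valuation R[X] Γ where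
  toFun := coeffSup v
  map_zero' := by simpa [coeffSup] using bot_le.antisymm zero_le
  map_one' := by
    refine le_antisymm ((coeffSup_le_iff v).2 fun i ↦ ?_) ?_
    · rw [coeff_one]; split_ifs <;> simp
    · simpa using le_coeffSup v (1 : R[X]) 0
  map_mul' := coeffSup_mul v
  map_add_le_max' p q := (coeffSup_le_iff v).2 fun i ↦ by
    rw [coeff_add]
    exact (v.map_add _ _).trans (max_le_max (le_coeffSup v p i) (le_coeffSup v q i))

lemma le_gaussValuation (p : R[X]) (i : ℕ) : v (p.coeff i) ≤ gaussValuation v p :=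
  le_coeffSup v p i

lemma gaussValuation_le_iff {p : R[X]} {c : Γ} :
    gaussValuation v p ≤ c ↔ ∀ i, v (p.coeff i) ≤ c :=
  coeffSup_le_iff v

lemma gaussValuation_C (a : R) : gaussValuation v (C a) = v a := by
  refine le_antisymm ((gaussValuation_le_iff v).2 fun i ↦ ?_) ?_
  · rw [coeff_C]; split_ifs <;> simp
  · simpa using le_gaussValuation v (C a) 0

end Gauss

/-! ### Krull domains described by valuations on the ring itself. -/

/-- A family of discrete valuations of a domain that defines it as a Krull domain. -/
structure IsKrullFamily {A ι : Type*} [CommRing A] (v : ι → Valuation A ℤᵐ⁰) : Prop where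
  eq_zero : ∀ i a, v i a = 0 → a = 0
  le_one : ∀ i a, v i a ≤ 1
  dvd : ∀ a b, b ≠ 0 → (∀ i, v i a ≤ v i b) → b ∣ a
  finite : ∀ a, a ≠ 0 → {i | v i a ≠ 1}.Finite

/-- The extension of a faithful valuation of a domain to its field of fractions. -/
noncomputable def fractionValuation {A : Type*} [CommRing A] [IsDomain A] (v : Valuation A ℤᵐ⁰)
    (hv : ∀ a, v a = 0 → a = 0) : Valuation (FractionRing A) ℤᵐ⁰ :=
  v.extendToLocalization (S := A⁰) (fun s hs h ↦ nonZeroDivisors.ne_zero hs (hv s h)) _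

lemma fractionValuation_algebraMap {A : Type*} [CommRing A] [IsDomain A] (v : Valuation A ℤᵐ⁰)
    (hv : ∀ a, v a = 0 → a = 0) (a : A) :
    fractionValuation v hv (algebraMap A (FractionRing A) a) = v a :=
  v.extendToLocalization_apply_map_apply _ _ _

/-- The value group is a subgroup of an infinite cyclic group, hence cyclic, and it is nontrivial
because some element lies outside the valuation ring. -/
lemma isDiscreteValuationRing_valuationSubring {K : Type*} [Field K] (w : Valuation K ℤᵐ⁰)
    (hw : w.valuationSubring ≠ ⊤) : IsDiscreteValuationRing w.valuationSubring := by
  have : Nontrivial (MonoidWithZeroHom.valueGroup (.ofClass w)) := by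
    obtain ⟨x, hx⟩ : ∃ x, x ∉ w.valuationSubring := by
      by_contra! h
      exact hw (top_unique fun x _ ↦ h x)
    rw [Valuation.mem_valuationSubring_iff, not_le] at hx
    rw [Subgroup.nontrivial_iff_exists_ne_one]
    have hx0 : w x ≠ 0 := (zero_lt_one.trans hx).ne'
    refine ⟨Units.mk0 (w x) hx0, MonoidWithZeroHom.mem_valueGroup _ ⟨x, rfl⟩, fun h ↦ hx.ne' ?_⟩
    simpa using congrArg Units.val h
  have : IsCyclic (MonoidWithZeroHom.valueGroup (.ofClass w)) := inferInstance
  exact Valuation.valuationSubring_isDiscreteValuationRing w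

/-- With its converse `exists_isKrullFamily`, this turns the definition into conditions on elements
of `A`, which restrict to retracts and extend to polynomials without passing through fields of
fractions. -/
lemma IsKrullFamily.isKrullDomain {A ι : Type*} [CommRing A] [IsDomain A]
    {v : ι → Valuation A ℤᵐ⁰} (h : IsKrullFamily v) : IsKrullDomain A := by
  let w (i : ι) := fractionValuation (v i) (h.eq_zero i)
  have hw (i a) : w i (algebraMap A _ a) = v i a := fractionValuation_algebraMap _ _ _
  -- A Krull family may contain trivial valuations. Their valuation ring is the whole field, which
  -- is not a DVR and imposes no condition, so they are discarded.
  refine ⟨{V | V ≠ ⊤ ∧ ∃ i, V = (w i).valuationSubring}, ?_, fun x ↦ ?_, fun x hx ↦ ?_⟩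
  · rintro _ ⟨hV, i, rfl⟩
    exact isDiscreteValuationRing_valuationSubring _ hV
  · constructor
    · rintro ⟨a, rfl⟩ _ ⟨-, i, rfl⟩
      rw [Valuation.mem_valuationSubring_iff, hw]
      exact h.le_one i a
    · intro hx
      obtain ⟨a, b, hb, rfl⟩ := IsFractionRing.div_surjective A x
      have hb0 := nonZeroDivisors.ne_zero hb
      have hb' : algebraMap A (FractionRing A) b ≠ 0 := by simpa using hb0
      obtain ⟨c, rfl⟩ := h.dvd a b hb0 fun i ↦ by
        have : algebraMap A (FractionRing A) a / algebraMap A _ b ∈ (w i).valuationSubring := by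
          by_cases hi : (w i).valuationSubring = ⊤
          · rw [hi]; trivial
          · exact hx _ ⟨hi, i, rfl⟩
        rw [Valuation.mem_valuationSubring_iff, map_div₀, hw, hw] at this
        have hvb : 0 < v i b := zero_lt_iff.2 fun hh ↦ hb0 (h.eq_zero i b hh)
        rwa [div_le_one₀ hvb] at this
      exact ⟨c, by rw [map_mul]; field_simp⟩
  · obtain ⟨a, b, hb, rfl⟩ := IsFractionRing.div_surjective A x
    have hb0 := nonZeroDivisors.ne_zero hb
    have ha0 : a ≠ 0 := by rintro rfl; simp at hx
    refine (((h.finite a ha0).union (h.finite b hb0)).image fun i ↦ (w i).valuationSubring).subset ?_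
    rintro _ ⟨⟨-, i, rfl⟩, hi⟩
    refine ⟨i, ?_, rfl⟩
    by_contra hcon
    simp only [Set.mem_union, Set.mem_ofPred_eq, not_or, not_not] at hcon
    refine hi ((Valuation.isEquiv_iff_val_eq_one.1 (w i).isEquiv_valuation_valuationSubring).1 ?_)
    rw [map_div₀, hw, hw, hcon.1, hcon.2, div_one]

lemma exists_isKrullFamily (A : Type u) [CommRing A] [IsKrullDomain A] :
    ∃ (ι : Type u) (v : ι → Valuation A ℤᵐ⁰), IsKrullFamily v := by
  obtain ⟨𝒱, hdvr, hmem, hfin⟩ := IsKrullDomain.exists_valuationSubrings (R := A)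
  have (V : 𝒱) : IsDiscreteValuationRing V.1 := hdvr V V.2
  let w (V : 𝒱) : Valuation (FractionRing A) ℤᵐ⁰ :=
    (IsDiscreteValuationRing.maximalIdeal V.1).valuation (FractionRing A)
  have hw (V : 𝒱) (x) : w V x ≤ 1 ↔ x ∈ V.1 := by
    constructor
    · intro h
      obtain ⟨a, rfl⟩ := IsDiscreteValuationRing.exists_lift_of_le_one h
      exact a.2
    · intro h
      exact IsDedekindDomain.HeightOneSpectrum.valuation_le_one _ (⟨x, h⟩ : V.1)
  refine ⟨𝒱, fun V ↦ (w V).comap (algebraMap A (FractionRing A)), ?_, ?_, ?_, ?_⟩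
  · intro V a ha
    simpa using ha
  · intro V a
    exact (hw V _).2 ((hmem _).1 ⟨a, rfl⟩ V V.2)
  · intro a b hb hab
    have hb' : algebraMap A (FractionRing A) b ≠ 0 := by simpa using hb
    obtain ⟨c, hc⟩ := (hmem (algebraMap A (FractionRing A) a / algebraMap A _ b)).2 fun V hV ↦ by
      refine (hw ⟨V, hV⟩ _).1 ?_
      rw [map_div₀, div_le_one₀ (zero_lt_iff.2 ((Valuation.ne_zero_iff _).2 hb'))]
      exact hab ⟨V, hV⟩
    refine ⟨c, IsFractionRing.injective A (FractionRing A) ?_⟩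
    rw [map_mul, hc]
    field_simp
  · intro a ha
    have ha' : algebraMap A (FractionRing A) a ≠ 0 := by simpa using ha
    refine Set.Finite.of_finite_image ((hfin _ ha').subset ?_) Subtype.val_injective.injOn
    rintro _ ⟨V, hV, rfl⟩
    refine ⟨V.2, fun h ↦ hV ?_⟩
    have hequiv : V.1.valuation.IsEquiv (w V) := by
      rw [Valuation.isEquiv_iff_val_le_one]
      intro x
      rw [ValuationSubring.valuation_le_one_iff, hw]
    exact (Valuation.isEquiv_iff_val_eq_one.1 hequiv).1 h

/-- Substitute for Gauss's lemma on contents: at each valuation, the product of two coefficients is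
bounded by the Gauss value of `f * g`, hence by the value of `d`. -/
lemma IsKrullFamily.dvd_coeff_mul_coeff {A ι : Type*} [CommRing A] [IsDomain A]
    {v : ι → Valuation A ℤᵐ⁰} (hv : IsKrullFamily v) {d : A} {f g : A[X]} (hd : d ≠ 0)
    (h : Polynomial.C d ∣ f * g) (m n : ℕ) : d ∣ f.coeff m * g.coeff n := by
  refine hv.dvd _ _ hd fun i ↦ ?_
  obtain ⟨q, hq⟩ := h
  calc v i (f.coeff m * g.coeff n) = v i (f.coeff m) * v i (g.coeff n) := map_mul _ _ _
    _ ≤ gaussValuation (v i) f * gaussValuation (v i) g :=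
      mul_le_mul' (le_gaussValuation _ f m) (le_gaussValuation _ g n)
    _ = gaussValuation (v i) (Polynomial.C d) * gaussValuation (v i) q := by
      rw [← map_mul, hq, map_mul]
    _ ≤ v i d * 1 := by
      rw [gaussValuation_C]
      exact mul_le_mul' le_rfl ((gaussValuation_le_iff _).2 fun n ↦ hv.le_one i _)
    _ = v i d := mul_one _

lemma dvd_coeff_mul_coeff {A : Type*} [CommRing A] [IsKrullDomain A] {d : A} {f g : A[X]}
    (hd : d ≠ 0) (h : Polynomial.C d ∣ f * g) (m n : ℕ) : d ∣ f.coeff m * g.coeff n := by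
  obtain ⟨ι, v, hv⟩ := exists_isKrullFamily A
  exact hv.dvd_coeff_mul_coeff hd h m n

/-! ### Stability of Krull domains under polynomial extension and retracts. -/

/-- Denominators of a divisibility relation over the field of fractions can be cleared. -/
lemma exists_C_mul_eq_mul {A : Type*} [CommRing A] [IsDomain A] {f g : A[X]}
    (h : f.map (algebraMap A (FractionRing A)) ∣ g.map (algebraMap A (FractionRing A))) :
    ∃ a : A, a ≠ 0 ∧ ∃ q : A[X], Polynomial.C a * g = f * q := by
  obtain ⟨q, hq⟩ := h
  obtain ⟨a, ha₀, ha⟩ := IsLocalization.integerNormalization_spec A⁰ q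
  refine ⟨a, nonZeroDivisors.ne_zero ha₀, IsLocalization.integerNormalization A⁰ q, ?_⟩
  apply Polynomial.map_injective _ (IsFractionRing.injective A (FractionRing A))
  rw [Polynomial.map_mul, Polynomial.map_mul, ha, hq, Polynomial.map_C]
  rw [Algebra.smul_def, Polynomial.algebraMap_apply]
  ring

-- The defining family consists of the `P`-adic valuations of `K[X]`, which test divisibility over
-- `K`, and the Gauss extensions of the valuations of `A`, which control the remaining constant
-- denominators.
open Polynomial in
instance isKrullDomain_polynomial (A : Type*) [CommRing A] [IsKrullDomain A] :
    IsKrullDomain A[X] := by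
  obtain ⟨ι, v, hv⟩ := exists_isKrullFamily A
  let K := FractionRing A
  let j : A[X] →+* K[X] := mapRingHom (algebraMap A K)
  have hj : Function.Injective j := map_injective _ (IsFractionRing.injective A K)
  refine IsKrullFamily.isKrullDomain
    (v := Sum.elim (fun P : IsDedekindDomain.HeightOneSpectrum K[X] ↦ P.intValuation.comap j)
      fun i ↦ gaussValuation (v i)) ⟨?_, ?_, ?_, ?_⟩
  · rintro (P | i) f hf
    · by_contra h0
      exact P.intValuation_ne_zero (j f) ((map_ne_zero_iff j hj).2 h0) hf
    · ext n
      refine hv.eq_zero i _ (le_antisymm ?_ zero_le)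
      exact (le_gaussValuation (v i) f n).trans hf.le
  · rintro (P | i) f
    · exact P.intValuation_le_one _
    · exact (gaussValuation_le_iff _).2 fun n ↦ hv.le_one i _
  · intro g f hf hfg
    have hjf : j f ≠ 0 := (map_ne_zero_iff j hj).2 hf
    have hdvd : j f ∣ j g := by
      have hf' : algebraMap K[X] (FractionRing K[X]) (j f) ≠ 0 := by simpa using hjf
      obtain ⟨q, hq⟩ := IsDedekindDomain.HeightOneSpectrum.mem_integers_of_valuation_le_one
        (R := K[X]) (FractionRing K[X]) (algebraMap _ _ (j g) / algebraMap _ _ (j f)) fun P ↦ by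
          rw [map_div₀, div_le_one₀ (zero_lt_iff.2 ((Valuation.ne_zero_iff _).2 hf')),
            IsDedekindDomain.HeightOneSpectrum.valuation_of_algebraMap,
            IsDedekindDomain.HeightOneSpectrum.valuation_of_algebraMap]
          exact hfg (.inl P)
      refine ⟨q, IsFractionRing.injective K[X] (FractionRing K[X]) ?_⟩
      rw [map_mul, hq]
      field_simp
    obtain ⟨a, ha, q, hq⟩ := exists_C_mul_eq_mul hdvd
    have hCa : C a ≠ 0 := C_ne_zero.2 ha
    -- From `a g = f q` and `v(g) ≤ v(f)` for every Gauss valuation it follows that `v(q) ≤ v(a)`,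
    -- so `a` divides each coefficient of `q` and can be cancelled.
    have haq : C a ∣ q := by
      rw [C_dvd_iff_dvd_coeff]
      refine fun n ↦ hv.dvd _ _ ha fun i ↦ ?_
      refine (le_gaussValuation _ q n).trans ?_
      have h1 : v i a * gaussValuation (v i) g = gaussValuation (v i) f * gaussValuation (v i) q := by
        rw [← map_mul, ← hq, map_mul, gaussValuation_C]
      have h2 : gaussValuation (v i) g ≤ gaussValuation (v i) f := hfg (.inr i)
      have h3 : gaussValuation (v i) f ≠ 0 := fun h ↦ hf <| by
        ext n
        exact hv.eq_zero i _ (le_antisymm ((le_gaussValuation (v i) f n).trans h.le) zero_le)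
      refine le_of_mul_le_mul_left ?_ (zero_lt_iff.2 h3)
      rw [← h1, mul_comm]
      exact mul_le_mul' h2 le_rfl
    obtain ⟨q, rfl⟩ := haq
    refine ⟨q, mul_left_cancel₀ hCa ?_⟩
    rw [hq]
    ring
  · intro f hf
    have hjf : j f ≠ 0 := (map_ne_zero_iff j hj).2 hf
    have hlc : f.leadingCoeff ≠ 0 := leadingCoeff_ne_zero.2 hf
    have h1 : {P : IsDedekindDomain.HeightOneSpectrum K[X] | P.intValuation (j f) ≠ 1}.Finite := by
      refine (Ideal.finite_factors (I := Ideal.span {j f}) (by simpa using hjf)).subset ?_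
      intro P hP
      exact (P.intValuation_lt_one_iff_dvd _).1 (lt_of_le_of_ne (P.intValuation_le_one _) hP)
    -- A Gauss value of `f` lies between the value of the leading coefficient and 1, so it is 1 for
    -- all but finitely many `i`.
    refine ((h1.image Sum.inl).union ((hv.finite _ hlc).image Sum.inr)).subset ?_
    rintro (P | i) h
    · exact .inl ⟨P, h, rfl⟩
    · refine .inr ⟨i, fun hi ↦ h (le_antisymm ?_ ?_), rfl⟩
      · exact (gaussValuation_le_iff _).2 fun n ↦ hv.le_one i _
      · exact hi.ge.trans (le_gaussValuation (v i) f _)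

/-- A retract of a Krull domain is a Krull domain. -/
lemma isKrullDomain_of_retract {A B : Type*} [CommRing A] [CommRing B] [IsKrullDomain B]
    (i : A →+* B) (p : B →+* A) (h : p.comp i = RingHom.id A) : IsKrullDomain A := by
  have hpi (a) : p (i a) = a := congrArg (· a) h
  have hi : Function.Injective i := Function.LeftInverse.injective hpi
  have : IsDomain A := hi.isDomain i
  obtain ⟨ι, v, hv⟩ := exists_isKrullFamily B
  refine IsKrullFamily.isKrullDomain (v := fun j ↦ (v j).comap i) ⟨?_, ?_, ?_, ?_⟩
  · intro j a ha
    exact (map_eq_zero_iff i hi).1 (hv.eq_zero j _ ha)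
  · intro j a
    exact hv.le_one j _
  · intro a b hb hab
    -- Divisibility is obtained in `B` and brought back to `A` by the retraction.
    simpa [hpi] using map_dvd p (hv.dvd (i a) (i b) ((map_ne_zero_iff i hi).2 hb) hab)
  · intro a ha
    exact hv.finite _ ((map_ne_zero_iff i hi).2 ha)


/-! ### Divisorial ideals of polynomial rings are extended, up to principal factors. -/

section Polynomial

/-- An ideal of a domain is *divisorially closed* if it is an intersection of ideals of the form
`(b : c) = {x | b ∣ c * x}`. -/
def IsDivisoriallyClosed {A : Type*} [CommRing A] (J : Ideal A) : Prop :=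
  ∀ x, (∀ b c, b ≠ 0 → (∀ y ∈ J, b ∣ c * y) → b ∣ c * x) → x ∈ J

/-- Along `φ : A → B`, every nonzero divisorially closed ideal of `B` is, up to principal factors,
the extension of a divisorially closed ideal of `A`. -/
def ExtendsAllClasses {A B : Type*} [CommRing A] [CommRing B] (φ : A →+* B) : Prop :=
  ∀ J : Ideal B, J ≠ ⊥ → IsDivisoriallyClosed J →
    ∃ L : Ideal A, L ≠ ⊥ ∧ IsDivisoriallyClosed L ∧ ∃ f g : B, f ≠ 0 ∧ g ≠ 0 ∧
      Ideal.span {f} * J = Ideal.span {g} * L.map φ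

lemma ExtendsAllClasses.comp {A B C : Type*} [CommRing A] [CommRing B] [CommRing C] [IsDomain C]
    {ψ : B →+* C} {φ : A →+* B} (hψ : ExtendsAllClasses ψ) (hφ : ExtendsAllClasses φ)
    (hinj : Function.Injective ψ) : ExtendsAllClasses (ψ.comp φ) := by
  intro J hJ hJd
  obtain ⟨M, hM, hMd, f, g, hf, hg, h⟩ := hψ J hJ hJd
  obtain ⟨L, hL, hLd, f', g', hf', hg', h'⟩ := hφ M hM hMd
  refine ⟨L, hL, hLd, ψ f' * f, g * ψ g', mul_ne_zero ((map_ne_zero_iff ψ hinj).2 hf') hf,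
    mul_ne_zero hg ((map_ne_zero_iff ψ hinj).2 hg'), ?_⟩
  have h'' := congrArg (Ideal.map ψ) h'
  simp only [Ideal.map_mul, Ideal.map_span, Set.image_singleton, Ideal.map_map] at h''
  rw [← Ideal.span_singleton_mul_span_singleton, ← Ideal.span_singleton_mul_span_singleton,
    mul_assoc, h, mul_left_comm, h'', mul_assoc]

lemma extendsAllClasses_ringEquiv {A B : Type*} [CommRing A] [CommRing B] [Nontrivial B]
    (e : A ≃+* B) : ExtendsAllClasses (e : A →+* B) := by
  intro J hJ hJd
  refine ⟨J.comap (e : A →+* B), ?_, ?_, 1, 1, one_ne_zero, one_ne_zero, ?_⟩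
  · obtain ⟨x, hx, hx0⟩ := Submodule.exists_mem_ne_zero_of_ne_bot hJ
    refine (Submodule.ne_bot_iff _).2 ⟨e.symm x, ?_, by simpa using hx0⟩
    change e (e.symm x) ∈ J
    rwa [e.apply_symm_apply]
  · intro x hx
    refine hJd _ fun b c hb hbc ↦ ?_
    have := hx (e.symm b) (e.symm c) (by simpa using hb) fun y hy ↦ by
      simpa using map_dvd e.symm (hbc (e y) hy)
    simpa using map_dvd e this
  · rw [Ideal.map_comap_of_surjective (e : A →+* B) e.surjective]

open Polynomial

/-- Every nonzero ideal of `A[X]` contains a generator of its extension to `K[X]`. -/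
lemma exists_mem_forall_dvd_C_mul {A : Type*} [CommRing A] [IsDomain A] {J : Ideal A[X]}
    (hJ : J ≠ ⊥) : ∃ f ∈ J, f ≠ 0 ∧ ∀ j ∈ J, ∃ a : A, a ≠ 0 ∧ f ∣ C a * j := by
  have h : ∃ n, ∃ f ∈ J, f ≠ 0 ∧ f.natDegree = n := by
    obtain ⟨x, hx, hx0⟩ := Submodule.exists_mem_ne_zero_of_ne_bot hJ
    exact ⟨_, x, hx, hx0, rfl⟩
  classical
  -- Take `f` of least degree among the nonzero elements of `J`. A nonzero remainder modulo `f` over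
  -- `K`, cleared of denominators, would be an element of `J` of smaller degree.
  obtain ⟨f, hfJ, hf0, hfn⟩ := Nat.find_spec h
  refine ⟨f, hfJ, hf0, fun j hj ↦ ?_⟩
  let φ := algebraMap A (FractionRing A)
  have hφ : Function.Injective φ := IsFractionRing.injective A (FractionRing A)
  have hdvd : f.map φ ∣ j.map φ := by
    have hf' : f.map φ ≠ 0 := (Polynomial.map_ne_zero_iff hφ).2 hf0
    by_contra hcon
    rw [← EuclideanDomain.mod_eq_zero] at hcon
    obtain ⟨a, ha₀, ha⟩ := IsLocalization.integerNormalization_spec A⁰ (j.map φ / f.map φ)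
    have ha₀ := nonZeroDivisors.ne_zero ha₀
    set q := IsLocalization.integerNormalization A⁰ (j.map φ / f.map φ)
    have hr : (C a * j - f * q).map φ = C (φ a) * (j.map φ % f.map φ) := by
      rw [Polynomial.map_sub, Polynomial.map_mul, Polynomial.map_mul, ha, map_C,
        EuclideanDomain.mod_eq_sub_mul_div, Algebra.smul_def, Polynomial.algebraMap_apply]
      ring
    have hCa : C (φ a) ≠ 0 := C_ne_zero.2 ((map_ne_zero_iff φ hφ).2 ha₀)
    have hr0 : C a * j - f * q ≠ 0 := by
      rw [← Polynomial.map_ne_zero_iff hφ, hr]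
      exact mul_ne_zero hCa hcon
    refine Nat.find_min h (m := (C a * j - f * q).natDegree) ?_
      ⟨_, J.sub_mem (J.mul_mem_left _ hj) (J.mul_mem_right _ hfJ), hr0, rfl⟩
    rw [← hfn, ← natDegree_map_eq_of_injective hφ, hr, natDegree_C_mul ((map_ne_zero_iff φ hφ).2 ha₀),
      ← natDegree_map_eq_of_injective hφ f]
    refine natDegree_lt_natDegree hcon ?_
    exact EuclideanDomain.mod_lt _ hf'
  obtain ⟨a, ha, q, hq⟩ := exists_C_mul_eq_mul hdvd
  exact ⟨a, ha, q, hq⟩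

/-- Let `f ∈ J` generate `J K[X]` and let `d` be its leading coefficient. Gauss's lemma gives `f ∣ d
j` for all `j ∈ J`, so `J₁ = (d / f) J` is an integral ideal, and it contains the constant `d`. A
divisorially closed ideal containing a nonzero constant is extended from its contraction `L`. -/
lemma extendsAllClasses_polynomial (A : Type*) [CommRing A] [IsKrullDomain A] :
    ExtendsAllClasses (C : A →+* A[X]) := by
  intro J hJ hJd
  obtain ⟨f, hfJ, hf0, hf⟩ := exists_mem_forall_dvd_C_mul hJ
  set d := f.leadingCoeff with hd
  have hd0 : d ≠ 0 := leadingCoeff_ne_zero.2 hf0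
  have hCd : C d ≠ 0 := C_ne_zero.2 hd0
  have hdvd : ∀ j ∈ J, f ∣ C d * j := by
    intro j hj
    obtain ⟨a, ha, q, hq⟩ := hf j hj
    have hdq : C a ∣ C d * q := by
      rw [C_dvd_iff_dvd_coeff]
      intro n
      rw [coeff_C_mul]
      -- The coefficient of `f` used here is the leading one, `d`.
      exact dvd_coeff_mul_coeff ha ⟨j, hq.symm⟩ _ n
    obtain ⟨q', hq'⟩ := hdq
    refine ⟨q', mul_left_cancel₀ (C_ne_zero.2 ha) ?_⟩
    linear_combination C d * hq + f * hq'
  let J₁ : Ideal A[X] := Submodule.comap (LinearMap.mulLeft A[X] f) (Ideal.span {C d} * J)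
  have hJ₁ {h : A[X]} : h ∈ J₁ ↔ ∃ j ∈ J, C d * j = f * h := by
    simp only [J₁, Submodule.mem_comap, LinearMap.mulLeft_apply, Ideal.mem_span_singleton_mul]
  have hdJ₁ : C d ∈ J₁ := hJ₁.2 ⟨f, hfJ, mul_comm _ _⟩
  have hJ₁d : IsDivisoriallyClosed J₁ := by
    intro x hx
    have hfx : C d ∣ f * x := hx (C d) f hCd fun y hy ↦ by
      obtain ⟨j, -, hj⟩ := hJ₁.1 hy
      exact ⟨j, hj.symm⟩
    obtain ⟨j, hj⟩ := hfx
    refine hJ₁.2 ⟨j, hJd _ fun b c hb hbc ↦ ?_, hj.symm⟩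
    have := hx (C d * b) (f * c) (mul_ne_zero hCd hb) fun y hy ↦ by
      obtain ⟨k, hk, hky⟩ := hJ₁.1 hy
      obtain ⟨t, ht⟩ := hbc k hk
      exact ⟨t, by linear_combination (-c) * hky + C d * ht⟩
    obtain ⟨t, ht⟩ := this
    exact ⟨t, mul_left_cancel₀ hCd (by linear_combination ht - c * hj)⟩
  -- Since `d ∈ J₁`, a condition `b ∣ c y` valid on `J₁` gives `d c = b h`, and for `b ≠ 0` it is
  -- then equivalent to `d ∣ h y`. The modulus is now a constant, so Gauss's lemma applies
  -- coefficientwise.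
  have hcof {b c : A[X]} (hbc : ∀ y ∈ J₁, b ∣ c * y) : ∃ h, C d * c = b * h ∧
      ∀ y ∈ J₁, b ≠ 0 → C d ∣ h * y := by
    obtain ⟨h, hh⟩ := hbc _ hdJ₁
    refine ⟨h, by rw [← hh, mul_comm], fun y hy hb ↦ ?_⟩
    obtain ⟨t, ht⟩ := hbc y hy
    exact ⟨t, mul_left_cancel₀ hb (by linear_combination C d * ht - y * hh)⟩
  let L : Ideal A := J₁.comap C
  have hLJ₁ : L.map C = J₁ := by
    refine le_antisymm Ideal.map_comap_le fun y hy ↦ ?_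
    rw [Ideal.mem_map_C_iff]
    intro n
    refine hJ₁d _ fun b c hb hbc ↦ ?_
    obtain ⟨h, hh, hh'⟩ := hcof hbc
    have : C d ∣ h * C (y.coeff n) := by
      rw [C_dvd_iff_dvd_coeff]
      intro m
      rw [coeff_mul_C]
      exact dvd_coeff_mul_coeff hd0 (hh' y hy hb) m n
    obtain ⟨t, ht⟩ := this
    exact ⟨t, mul_left_cancel₀ hCd (by linear_combination C (y.coeff n) * hh + b * ht)⟩
  refine ⟨L, (Submodule.ne_bot_iff _).2 ⟨d, hdJ₁, hd0⟩, fun r hr ↦ ?_, C d, f, hCd, hf0, ?_⟩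
  -- Each condition `d ∣ h y` defining `J₁` splits, for constant `y`, into the conditions `d ∣
  -- h.coeff m * y` over `A`, which hold on `L` and hence for `r`.
  · refine hJ₁d _ fun b c hb hbc ↦ ?_
    obtain ⟨h, hh, hh'⟩ := hcof hbc
    have : C d ∣ h * C r := by
      rw [C_dvd_iff_dvd_coeff]
      intro m
      rw [coeff_mul_C]
      refine hr d (h.coeff m) hd0 fun y hy ↦ ?_
      have := (C_dvd_iff_dvd_coeff _ _).1 (hh' (C y) hy hb) m
      rwa [coeff_mul_C] at this
    obtain ⟨t, ht⟩ := this
    exact ⟨t, mul_left_cancel₀ hCd (by linear_combination C r * hh + b * ht)⟩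
  · rw [hLJ₁]
    ext x
    simp only [Ideal.mem_span_singleton_mul]
    constructor
    · rintro ⟨j, hj, rfl⟩
      obtain ⟨h, hh⟩ := hdvd j hj
      exact ⟨h, hJ₁.2 ⟨j, hj, hh⟩, hh.symm⟩
    · rintro ⟨h, hh, rfl⟩
      exact hJ₁.1 hh

lemma isKrullDomain_of_ringEquiv {A B : Type*} [CommRing A] [CommRing B] [IsKrullDomain B]
    (e : A ≃+* B) : IsKrullDomain A :=
  isKrullDomain_of_retract (e : A →+* B) (e.symm : B →+* A) (by ext; simp)

lemma isKrullDomain_and_extendsAllClasses_mvPolynomial (A : Type*) [CommRing A] [IsKrullDomain A]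
    (n : ℕ) : IsKrullDomain (MvPolynomial (Fin n) A) ∧
      ExtendsAllClasses (MvPolynomial.C : A →+* MvPolynomial (Fin n) A) := by
  induction n with
  | zero =>
    let e := (MvPolynomial.isEmptyAlgEquiv A (Fin 0)).symm
    have := isKrullDomain_of_ringEquiv e.symm.toRingEquiv
    refine ⟨this, ?_⟩
    have h : (MvPolynomial.C : A →+* MvPolynomial (Fin 0) A) = (e.toRingEquiv : A →+* _) := by
      ext a : 1
      exact (e.commutes a).symm
    rw [h]
    exact extendsAllClasses_ringEquiv _
  | succ n ih =>
    obtain ⟨hK, hE⟩ := ih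
    let e := (MvPolynomial.finSuccEquiv A n).symm
    have := isKrullDomain_of_ringEquiv e.symm.toRingEquiv
    refine ⟨this, ?_⟩
    have h : (MvPolynomial.C : A →+* MvPolynomial (Fin (n + 1)) A) =
        (e.toRingEquiv : (MvPolynomial (Fin n) A)[X] →+* MvPolynomial (Fin (n + 1)) A).comp
          (Polynomial.C.comp MvPolynomial.C) := by
      ext a : 1
      exact (e.commutes a).symm
    rw [h]
    exact (extendsAllClasses_ringEquiv _).comp
      ((extendsAllClasses_polynomial _).comp hE C_injective) e.injective


end Polynomial

/-! ### Divisorial fractional ideals and divisibility conditions. -/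

section Fractional

variable {A : Type*} [CommRing A] [IsDomain A]

open FractionalIdeal

lemma spanSingleton_mul_inv {x : FractionRing A} (hx : x ≠ 0)
    {I : FractionalIdeal A⁰ (FractionRing A)} (hI : I ≠ 0) :
    (spanSingleton A⁰ x * I)⁻¹ = spanSingleton A⁰ x⁻¹ * I⁻¹ := by
  have hx1 : spanSingleton A⁰ x⁻¹ * spanSingleton A⁰ x = 1 := by
    rw [spanSingleton_mul_spanSingleton, inv_mul_cancel₀ hx, spanSingleton_one]
  have hxI := frac_mul_ne_zero (spanSingleton_ne_zero_iff.2 hx) hI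
  apply le_antisymm
  · have h : spanSingleton A⁰ x * (spanSingleton A⁰ x * I)⁻¹ ≤ I⁻¹ := by
      rw [le_inv_iff_mul_le_one hI, mul_comm (spanSingleton A⁰ x), mul_assoc,
        ← le_inv_iff_mul_le_one hxI]
    calc _ = spanSingleton A⁰ x⁻¹ * (spanSingleton A⁰ x * (spanSingleton A⁰ x * I)⁻¹) := by
          rw [← mul_assoc, hx1, one_mul]
      _ ≤ _ := mul_le_mul' le_rfl h
  · rw [le_inv_iff_mul_le_one hxI, mul_mul_mul_comm, hx1, one_mul, ← le_inv_iff_mul_le_one hI]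

lemma IsDivisorial.spanSingleton_mul {x : FractionRing A} (hx : x ≠ 0)
    {I : FractionalIdeal A⁰ (FractionRing A)} (hI : IsDivisorial I) :
    IsDivisorial (spanSingleton A⁰ x * I) := by
  refine ⟨frac_mul_ne_zero (spanSingleton_ne_zero_iff.2 hx) hI.1, ?_⟩
  rw [spanSingleton_mul_inv hx hI.1, spanSingleton_mul_inv (inv_ne_zero hx)
    (inv_ne_zero_of_ne_zero hI.1), inv_inv, hI.2]

/-- A fraction `c / b` lies in `I⁻¹` exactly when `b ∣ c y` for all `y ∈ I`, so membership of `x` in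
`(I⁻¹)⁻¹` is the family of conditions `b ∣ c x`. -/
lemma isDivisorial_coeIdeal_iff {I : Ideal A} (hI : I ≠ ⊥) :
    IsDivisorial (I : FractionalIdeal A⁰ (FractionRing A)) ↔ IsDivisoriallyClosed I := by
  have hI0 : (I : FractionalIdeal A⁰ (FractionRing A)) ≠ 0 := coeIdeal_ne_zero.2 hI
  have hI' := inv_ne_zero_of_ne_zero hI0
  constructor
  · intro h x hx
    have hmem : algebraMap A (FractionRing A) x ∈ (I : FractionalIdeal A⁰ (FractionRing A)) := by
      rw [← h.2, mem_inv_iff hI']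
      intro y hy
      rw [mem_inv_iff hI0] at hy
      obtain ⟨c, b, hb, rfl⟩ := IsFractionRing.div_surjective A y
      have hb0 := nonZeroDivisors.ne_zero hb
      have hb' : algebraMap A (FractionRing A) b ≠ 0 := by simpa using hb0
      obtain ⟨t, ht⟩ := hx b c hb0 fun z hz ↦ by
        obtain ⟨t, ht⟩ := (mem_one_iff _).1 (hy _ (mem_coeIdeal_of_mem A⁰ hz))
        refine ⟨t, IsFractionRing.injective A (FractionRing A) ?_⟩
        rw [map_mul, map_mul, ht]
        field_simp
      refine (mem_one_iff _).2 ⟨t, ?_⟩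
      field_simp
      rw [← map_mul, ← map_mul, mul_comm x c, ht, mul_comm]
    obtain ⟨y, hy, hyx⟩ := (mem_coeIdeal _).1 hmem
    exact IsFractionRing.injective A (FractionRing A) hyx ▸ hy
  · intro h
    refine ⟨hI0, le_antisymm (fun x hx ↦ ?_) (le_inv_inv hI0)⟩
    have hx' := (mem_inv_iff hI').1 hx
    obtain ⟨r, rfl⟩ : ∃ r, algebraMap A (FractionRing A) r = x := by
      simpa [mem_one_iff] using hx' 1 ((mem_inv_iff hI0).2 fun y hy ↦ by
        simpa using coeIdeal_le_one hy)
    refine mem_coeIdeal_of_mem A⁰ (h r fun b c hb hbc ↦ ?_)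
    have hb' : algebraMap A (FractionRing A) b ≠ 0 := by simpa using hb
    obtain ⟨t, ht⟩ := (mem_one_iff _).1 <| hx' (algebraMap A _ c / algebraMap A _ b) <|
      (mem_inv_iff hI0).2 fun y hy ↦ by
        obtain ⟨z, hz, rfl⟩ := (mem_coeIdeal _).1 hy
        obtain ⟨t, ht⟩ := hbc z hz
        refine (mem_one_iff _).2 ⟨t, ?_⟩
        field_simp
        rw [← map_mul, ← map_mul, ht, mul_comm]
    refine ⟨t, IsFractionRing.injective A (FractionRing A) ?_⟩
    rw [map_mul, map_mul, ht]
    field_simp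

end Fractional

/-! ### Extension of divisorial ideals along a projective algebra. -/

section Extension

variable {A B : Type*} [CommRing A] [IsDomain A] [CommRing B] [IsDomain B] [Algebra A B]
  [Module.IsTorsionFree A B]

open FractionalIdeal

/-- The nontrivial inclusion writes `z ∈ (IB)⁻¹` as a `B`-combination of elements of `I⁻¹`. Fix a
nonzero `x₀ ∈ I`, so that `b₀ = z x₀` lies in `B`; a splitting `s` of the free `A`-module on `B`
onto `B` gives coordinates of `b₀`, and these divided by `x₀` are the coefficients. -/
lemma extendedHom_inv [Module.Projective A B] {I : FractionalIdeal A⁰ (FractionRing A)}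
    (hI : I ≠ 0) :
    extendedHom (FractionRing B) B I⁻¹ = (extendedHom (FractionRing B) B I)⁻¹ := by
  have hI' : extendedHom (FractionRing B) B I ≠ 0 := (extendedHom_eq_zero_iff _ _).not.2 hI
  refine le_antisymm ?_ fun z hz ↦ ?_
  · rw [le_inv_iff_mul_le_one hI', ← map_mul]
    exact extended_le_one_of_le_one _ _ _ ((le_inv_iff_mul_le_one hI).1 le_rfl)
  have hinj := FaithfulSMul.algebraMap_injective A B
  let μ : FractionRing A →+* FractionRing B := IsFractionRing.map hinj
  have hμ (a : A) : μ (algebraMap A _ a) = algebraMap B _ (algebraMap A B a) :=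
    IsLocalization.map_eq _ a
  have hmem {J : FractionalIdeal A⁰ (FractionRing A)} {x} (hx : x ∈ J) :
      μ x ∈ extendedHom (FractionRing B) B J :=
    (mem_extended_iff _ _ _ _).2 (Submodule.subset_span ⟨x, hx, rfl⟩)
  have hzB : ∀ x ∈ I, ∃ b : B, algebraMap B (FractionRing B) b = z * μ x := fun x hx ↦
    (mem_one_iff _).1 ((mem_inv_iff hI').1 hz _ (hmem hx))
  obtain ⟨x₀, hx₀, hx₀0⟩ : ∃ x ∈ I, x ≠ 0 := by
    by_contra! h
    exact hI (eq_zero_iff.2 h)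
  obtain ⟨b₀, hb₀⟩ := hzB x₀ hx₀
  obtain ⟨s, hs⟩ := (Module.projective_def' (R := A) (P := B)).1 inferInstance
  have hsum (b : B) : (s b).sum (fun i a ↦ a • i) = b := by
    simpa [Finsupp.linearCombination_apply] using congrArg (· b) hs
  have hcoef (i : B) : algebraMap A _ (s b₀ i) / x₀ ∈ I⁻¹ := by
    rw [mem_inv_iff hI]
    intro x hx
    obtain ⟨b, hb⟩ := hzB x hx
    -- With `x / x₀ = p / q` and `b = z x`, the relation `q b = p b₀` passes to coordinates by
    -- linearity of `s`. Hence `x` times `s b₀ i / x₀` is the coordinate `s b i`, an element of `A`.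
    obtain ⟨p, q, hq, hpq⟩ := IsFractionRing.div_surjective A (x / x₀)
    have hq' : algebraMap A (FractionRing A) q ≠ 0 := by
      simpa using nonZeroDivisors.ne_zero hq
    have hx' : algebraMap A _ q * x = algebraMap A _ p * x₀ := by
      field_simp at hpq
      rw [← hpq]
    have hbb : q • b = p • b₀ := by
      apply IsFractionRing.injective B (FractionRing B)
      have := congrArg μ hx'
      rw [map_mul, map_mul, hμ, hμ] at this
      rw [Algebra.smul_def, Algebra.smul_def, map_mul, map_mul, hb, hb₀]
      linear_combination z * this
    have hsi : q * s b i = p * s b₀ i := by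
      simpa using congrArg (fun b ↦ s b i) hbb
    refine (mem_one_iff _).2 ⟨s b i, mul_left_cancel₀ hq' ?_⟩
    rw [← map_mul, hsi, map_mul]
    field_simp
    linear_combination (-algebraMap A (FractionRing A) (s b₀ i)) * hx'
  have hz' : z = (s b₀).sum fun i a ↦ i • μ (algebraMap A _ a / x₀) := by
    have hμx : μ x₀ ≠ 0 := (map_ne_zero μ).2 hx₀0
    apply mul_right_cancel₀ hμx
    rw [← hb₀, Finsupp.sum_mul]
    conv_lhs => rw [← hsum b₀]
    rw [Finsupp.sum, map_sum]
    refine Finset.sum_congr rfl fun i _ ↦ ?_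
    change _ = i • μ (_ / x₀) * μ x₀
    rw [map_div₀, hμ, Algebra.smul_def, Algebra.smul_def, map_mul]
    field_simp
  rw [hz']
  exact Submodule.sum_mem _ fun i _ ↦ Submodule.smul_mem _ _ (hmem (hcoef i))

lemma IsDivisorial.extendedHom [Module.Projective A B]
    {I : FractionalIdeal A⁰ (FractionRing A)} (hI : IsDivisorial I) :
    IsDivisorial (FractionalIdeal.extendedHom (FractionRing B) B I) := by
  refine ⟨(extendedHom_eq_zero_iff _ _).not.2 hI.1, ?_⟩
  rw [← extendedHom_inv hI.1, ← extendedHom_inv (inv_ne_zero_of_ne_zero hI.1), hI.2]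

end Extension

/-! ### The induced map of divisor class groups. -/

section ClassGroup

lemma divisorClass_eq_of_val_eq {A : Type*} [CommRing A] [IsKrullDomain A]
    {I J : DivisorialIdeal A} {x : FractionRing A} (hx : x ≠ 0)
    (h : I.val = FractionalIdeal.spanSingleton A⁰ x * J.val) : divisorClass I = divisorClass J := by
  have : I = principalDivisor A (Units.mk0 x hx) * J := DivisorialIdeal.ext <| by
    rw [DivisorialIdeal.val_mul, ← I.isDivisorial.2, h]
    rfl
  rw [this]
  symm
  exact QuotientGroup.eq.2 ⟨Units.mk0 x hx, by rw [mul_comm _ J, inv_mul_cancel_left]⟩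

variable (A B : Type*) [CommRing A] [IsKrullDomain A] [CommRing B] [IsKrullDomain B] [Algebra A B]
  [Module.IsTorsionFree A B] [Module.Projective A B]

/-- Extension of divisorial ideals to a ring that is projective as a module. -/
noncomputable def extendDivisor : DivisorialIdeal A →* DivisorialIdeal B where
  toFun I := ⟨FractionalIdeal.extendedHom (FractionRing B) B I.val, I.isDivisorial.extendedHom⟩
  map_one' := DivisorialIdeal.ext (map_one _)
  map_mul' I J := DivisorialIdeal.ext <| by
    have h := frac_mul_ne_zero I.isDivisorial.1 J.isDivisorial.1
    simp only [DivisorialIdeal.val_mul]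
    rw [extendedHom_inv (inv_ne_zero_of_ne_zero h), extendedHom_inv h, map_mul]

lemma extendDivisor_val (I : DivisorialIdeal A) :
    (extendDivisor A B I).val = FractionalIdeal.extendedHom (FractionRing B) B I.val := rfl

/-- The homomorphism of divisor class groups induced by the extension of divisorial ideals. -/
noncomputable def extendClass : DivisorClassGroup A →* DivisorClassGroup B :=
  QuotientGroup.map _ _ (extendDivisor A B) <| by
    rintro _ ⟨x, rfl⟩
    refine ⟨Units.map (IsFractionRing.map (FaithfulSMul.algebraMap_injective A B) :
      FractionRing A →+* FractionRing B) x, DivisorialIdeal.ext ?_⟩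
    exact (FractionalIdeal.extendedHom_spanSingleton _ _ _).symm

lemma extendClass_divisorClass (I : DivisorialIdeal A) :
    extendClass A B (divisorClass I) = divisorClass (extendDivisor A B I) := rfl

variable {A B}

-- After clearing denominators, the extension to `B` of an ideal `J` of `A` is generated by some
-- `b`. Applying the retraction `ε` to this equality of ideals gives `J = (ε b)`.
open FractionalIdeal in
lemma extendClass_injective (ε : B →ₐ[A] A) : Function.Injective (extendClass A B) := by
  rw [injective_iff_map_eq_one]
  intro c hc
  obtain ⟨I, rfl⟩ := QuotientGroup.mk_surjective c
  obtain ⟨g, hg⟩ := (QuotientGroup.eq_one_iff _).1 hc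
  have hg' : spanSingleton B⁰ (g : FractionRing B) = extendedHom (FractionRing B) B I.val :=
    congrArg DivisorialIdeal.val hg
  obtain ⟨a, J, ha, hIJ⟩ := exists_eq_spanSingleton_mul I.val
  have hinj := FaithfulSMul.algebraMap_injective A B
  have ha' : algebraMap A (FractionRing A) a ≠ 0 := by simpa using ha
  have haJ : (J : FractionalIdeal A⁰ (FractionRing A)) =
      spanSingleton A⁰ (algebraMap A _ a) * I.val := by
    rw [hIJ, ← mul_assoc, spanSingleton_mul_spanSingleton, mul_inv_cancel₀ ha', spanSingleton_one,
      one_mul]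
  have hJ : ((J.map (algebraMap A B) : Ideal B) : FractionalIdeal B⁰ (FractionRing B)) =
      spanSingleton B⁰ (algebraMap B (FractionRing B) (algebraMap A B a) * (g : FractionRing B)) := by
    rw [← extendedHom_coeIdeal_eq_map (K := FractionRing A), haJ, map_mul,
      extendedHom_spanSingleton, ← hg', spanSingleton_mul_spanSingleton]
    congr 2
    exact IsLocalization.map_eq _ a
  obtain ⟨b, -, hb⟩ := (mem_coeIdeal B⁰).1 (hJ ▸ mem_spanSingleton_self B⁰ _)
  rw [← hb, ← coeIdeal_span_singleton, coeIdeal_inj] at hJ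
  have hJ' : J = Ideal.span {ε b} := by
    have := congrArg (Ideal.map (ε : B →+* A)) hJ
    rw [Ideal.map_map, Ideal.map_span, Set.image_singleton] at this
    have hid : (ε : B →+* A).comp (algebraMap A B) = RingHom.id A := by
      ext x
      exact ε.commutes x
    rwa [hid, Ideal.map_id] at this
  have hIs : I.val = spanSingleton A⁰ ((algebraMap A _ a)⁻¹ * algebraMap A _ (ε b)) := by
    rw [hIJ, hJ', coeIdeal_span_singleton, spanSingleton_mul_spanSingleton]
  have hne : (algebraMap A (FractionRing A) a)⁻¹ * algebraMap A _ (ε b) ≠ 0 := fun h ↦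
    I.isDivisorial.1 (by rw [hIs, h, spanSingleton_zero])
  exact (QuotientGroup.eq_one_iff _).2 ⟨Units.mk0 _ hne, DivisorialIdeal.ext hIs.symm⟩

open FractionalIdeal in
lemma extendClass_surjective (h : ExtendsAllClasses (algebraMap A B)) :
    Function.Surjective (extendClass A B) := by
  intro c
  obtain ⟨I, rfl⟩ := QuotientGroup.mk_surjective c
  obtain ⟨a, J, ha, hIJ⟩ := exists_eq_spanSingleton_mul I.val
  have ha' : algebraMap B (FractionRing B) a ≠ 0 := by simpa using ha
  have haJ : (J : FractionalIdeal B⁰ (FractionRing B)) =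
      spanSingleton B⁰ (algebraMap B _ a) * I.val := by
    rw [hIJ, ← mul_assoc, spanSingleton_mul_spanSingleton, mul_inv_cancel₀ ha', spanSingleton_one,
      one_mul]
  have hJd : IsDivisorial (J : FractionalIdeal B⁰ (FractionRing B)) :=
    haJ ▸ I.isDivisorial.spanSingleton_mul ha'
  have hJ0 : J ≠ ⊥ := coeIdeal_ne_zero.1 hJd.1
  obtain ⟨L, hL, hLd, f, g, hf, hg, hfg⟩ := h J hJ0 ((isDivisorial_coeIdeal_iff hJ0).1 hJd)
  have hf' : algebraMap B (FractionRing B) f ≠ 0 := by simpa using hf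
  have hg' : algebraMap B (FractionRing B) g ≠ 0 := by simpa using hg
  let M : DivisorialIdeal A := ⟨L, (isDivisorial_coeIdeal_iff hL).2 hLd⟩
  refine ⟨divisorClass M, ?_⟩
  symm
  rw [extendClass_divisorClass]
  refine divisorClass_eq_of_val_eq (x := (algebraMap B _ a)⁻¹ * ((algebraMap B _ f)⁻¹ *
    algebraMap B _ g)) (by positivity) ?_
  have hfg' := congrArg (fun I : Ideal B ↦ (I : FractionalIdeal B⁰ (FractionRing B))) hfg
  simp only [coeIdeal_mul, coeIdeal_span_singleton] at hfg'
  rw [extendDivisor_val, extendedHom_coeIdeal_eq_map, hIJ, ← spanSingleton_mul_spanSingleton,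
    ← spanSingleton_mul_spanSingleton, mul_assoc, mul_assoc, ← hfg',
    ← mul_assoc _ _ (J : FractionalIdeal B⁰ (FractionRing B)),
    spanSingleton_mul_spanSingleton, inv_mul_cancel₀ hf', spanSingleton_one, one_mul]

lemma extendClass_extendClass {C : Type*} [CommRing C] [IsKrullDomain C] [Algebra A C] [Algebra B C]
    [IsScalarTower A B C] [Module.IsTorsionFree A C] [Module.Projective A C]
    [Module.IsTorsionFree B C] [Module.Projective B C] (c : DivisorClassGroup A) :
    extendClass B C (extendClass A B c) = extendClass A C c := by
  obtain ⟨I, rfl⟩ := QuotientGroup.mk_surjective c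
  refine congrArg divisorClass (DivisorialIdeal.ext ?_)
  rw [extendDivisor_val, extendDivisor_val, extendDivisor_val]
  simp only [FractionalIdeal.extendedHom'_apply]
  rw [FractionalIdeal.extended_extended]
  congr 1
  exact (IsScalarTower.algebraMap_eq A B C).symm

end ClassGroup


/-! ### Symmetric algebras of projective modules. -/

section SymmetricAlgebra

open scoped TensorProduct
open SymmetricAlgebra

variable (R : Type*) [CommRing R]

/-- `M` is a retract of a free module, so by functoriality its symmetric algebra is a retract of
that of the free module, which is projective. -/
lemma projective_symmetricAlgebra (M : Type*) [AddCommGroup M] [Module R M]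
    [Module.Projective R M] : Module.Projective R (SymmetricAlgebra R M) := by
  obtain ⟨s, hs⟩ := (Module.projective_def' (R := R) (P := M)).1 inferInstance
  let i : SymmetricAlgebra R M →ₐ[R] SymmetricAlgebra R (M →₀ R) := lift (ι R _ ∘ₗ s)
  let p : SymmetricAlgebra R (M →₀ R) →ₐ[R] SymmetricAlgebra R M :=
    lift (ι R M ∘ₗ Finsupp.linearCombination R id)
  have h : p.comp i = AlgHom.id R _ := by
    apply algHom_ext
    ext m
    simpa [i, p] using congrArg (fun f : M →ₗ[R] M ↦ ι R M (f m)) hs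
  exact Module.Projective.of_split i.toLinearMap p.toLinearMap (congrArg AlgHom.toLinearMap h)

attribute [local instance] projective_symmetricAlgebra

/-- The symmetric algebra of a direct sum is the tensor product of the symmetric algebras. -/
noncomputable def symmetricAlgebraProdEquiv (M N : Type*) [AddCommGroup M] [Module R M]
    [AddCommGroup N] [Module R N] :
    SymmetricAlgebra R (M × N) ≃ₐ[R] SymmetricAlgebra R M ⊗[R] SymmetricAlgebra R N :=
  AlgEquiv.ofAlgHom
    (lift (LinearMap.coprod
      (Algebra.TensorProduct.includeLeft.toLinearMap ∘ₗ ι R M)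
      (Algebra.TensorProduct.includeRight.toLinearMap ∘ₗ ι R N)))
    (Algebra.TensorProduct.productMap
      (lift (ι R (M × N) ∘ₗ LinearMap.inl R M N)) (lift (ι R (M × N) ∘ₗ LinearMap.inr R M N)))
    (by
      apply Algebra.TensorProduct.ext
      · apply algHom_ext
        ext m
        simp
      · apply algHom_ext
        ext m
        simp)
    (by
      apply algHom_ext
      ext m <;> simp)

/-- `F` is the kernel of a split surjection `R^n → E`. Its projectivity makes `Sym(F)` projective
over `R`, and so `S ⊗ Sym(F)` projective over `S`. -/
lemma exists_complement (E : Type*) [AddCommGroup E] [Module R E] [Module.Finite R E]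
    [Module.Projective R E] : ∃ (n : ℕ) (F : Submodule R (Fin n → R)),
      Module.Projective R F ∧ Nonempty ((E × F) ≃ₗ[R] (Fin n → R)) := by
  obtain ⟨n, f, hf⟩ := Module.Finite.exists_fin' R E
  obtain ⟨s, hs⟩ := Module.projective_lifting_property f LinearMap.id hf
  have hs' (x : E) : f (s x) = x := congrArg (fun g : E →ₗ[R] E ↦ g x) hs
  let p : (Fin n → R) →ₗ[R] LinearMap.ker f :=
    (LinearMap.id - s ∘ₗ f).codRestrict _ fun x ↦ by simp [hs']
  refine ⟨n, LinearMap.ker f, Module.Projective.of_split (LinearMap.ker f).subtype p ?_,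
    ⟨LinearEquiv.ofLinearMap (s.coprod (LinearMap.ker f).subtype) (f.prod p) ?_ ?_⟩⟩
  · ext x
    simp [p]
  · ext x
    simp [p]
  · ext x <;> simp [p, hs']

theorem exists_isKrullDomain_bijective_extendClass [IsKrullDomain R]
    (E : Type*) [AddCommGroup E] [Module R E] [Module.Finite R E] [Module.Projective R E] :
    ∃ _ : IsKrullDomain (SymmetricAlgebra R E),
      Function.Bijective (extendClass R (SymmetricAlgebra R E)) := by
  obtain ⟨n, F, hF, ⟨e⟩⟩ := exists_complement R E
  let S := SymmetricAlgebra R E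
  let T := S ⊗[R] SymmetricAlgebra R F
  let g : MvPolynomial (Fin n) R ≃ₐ[R] T :=
    (SymmetricAlgebra.equivMvPolynomial (Module.Basis.ofEquivFun e)).symm.trans
      (symmetricAlgebraProdEquiv R E F)
  obtain ⟨hP, hE⟩ := isKrullDomain_and_extendsAllClasses_mvPolynomial R n
  have hT : IsKrullDomain T := isKrullDomain_of_ringEquiv g.symm.toRingEquiv
  -- The retraction applies the augmentation `Sym(F) → R` to the second factor.
  let ε : T →ₐ[S] S := Algebra.TensorProduct.lift (AlgHom.id S S)
    ((Algebra.ofId R S).comp SymmetricAlgebra.algebraMapInv) fun _ _ ↦ Commute.all _ _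
  have hε : (ε : T →+* S).comp (algebraMap S T) = RingHom.id S := by
    ext x
    exact ε.commutes x
  have hS : IsKrullDomain S := isKrullDomain_of_retract (algebraMap S T) ε hε
  have hST : FaithfulSMul S T := (faithfulSMul_iff_algebraMap_injective S T).2
    (Function.LeftInverse.injective ε.commutes)
  have hRT : FaithfulSMul R T := (faithfulSMul_iff_algebraMap_injective R T).2 <| by
    rw [IsScalarTower.algebraMap_eq R S T]
    exact (FaithfulSMul.algebraMap_injective S T).comp (FaithfulSMul.algebraMap_injective R S)
  have hgC : algebraMap R T = (g.toRingEquiv : MvPolynomial (Fin n) R →+* T).comp MvPolynomial.C := by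
    ext a
    exact (g.commutes a).symm
  have hall : ExtendsAllClasses (algebraMap R T) := by
    rw [hgC]
    exact (extendsAllClasses_ringEquiv g.toRingEquiv).comp hE g.injective
  -- The image of `c` in `Cl(T)` comes from some `d` in `Cl(R)`. The image of `d` in `Cl(S)` equals
  -- `c` because `Cl(S) → Cl(T)` is injective.
  have hsurj : Function.Surjective (extendClass R S) := fun c ↦ by
    obtain ⟨d, hd⟩ := extendClass_surjective hall (extendClass S T c)
    exact ⟨d, extendClass_injective ε (by rw [extendClass_extendClass, hd])⟩
  exact ⟨hS, extendClass_injective SymmetricAlgebra.algebraMapInv, hsurj⟩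

end SymmetricAlgebra

end KrullDomain

theorem proposition3p3 {R : Type*} [CommRing R] [IsKrullDomain R]
    {E : Type*} [AddCommGroup E] [Module R E] [Module.Finite R E] [Module.Projective R E] :
    ∃ _ : IsKrullDomain (SymmetricAlgebra R E),
      ∃ φ : KrullDomain.DivisorClassGroup R ≃*
          KrullDomain.DivisorClassGroup (SymmetricAlgebra R E),
        ∀ L : KrullDomain.DivisorialIdeal R,
          ∃ hL : KrullDomain.IsDivisorial
              (FractionalIdeal.extendedHom (FractionRing (SymmetricAlgebra R E))
                (SymmetricAlgebra R E) L.val),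
            φ (KrullDomain.divisorClass L) = KrullDomain.divisorClass ⟨_, hL⟩ := by
  have := KrullDomain.projective_symmetricAlgebra R E
  obtain ⟨hS, h⟩ := KrullDomain.exists_isKrullDomain_bijective_extendClass R E
  exact ⟨hS, MulEquiv.ofBijective _ h, fun L ↦ ⟨L.isDivisorial.extendedHom, rfl⟩⟩
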